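/- For real $\nu<0$ let $D_\nu$ be the parabolic cylinder function, $$D_\nu(x)=\frac{e^{-x^2/4}}{\Gamma(-\nu)}\int_0^\infty t^{-\nu-1}e^{-\frac{t^2}{2}-xt}\,dt,\qquad x\in\mathbb{R},$$ and let $H_\nu:\mathbb{R}\to\mathbb{R}$ be the Hermite function of order $\nu$, that is, the solution of $u''(x)-2xu'(x)+2\nu u(x)=0$ on $\mathbb{R}$ determined by $$D_\nu(x)=2^{-\nu/2}e^{-x^2/4}H_\nu\!\left(\frac{x}{\sqrt2}\right),\qquad x\in\mathbb{R}.$$ Both functions are positive on $\mathbb{R}$. Then, for every $\nu<0$, the function $$\mathcal{R}_\nu(x)=\frac{H_{\nu-1}(x)^2}{H_\nu(x)\,H_{\nu-2}(x)},\qquad x\in\mathbb{R},$$ is strictly decreasing on $\mathbb{R}$. -/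

import Mathlib

noncomputable section

/-- The parabolic cylinder function `D_ν` on the real line, for `ν < 0`:
`D_ν(x) = exp(-x²/4) / Γ(-ν) * ∫_0^∞ t^(-ν-1) exp(-t²/2 - x t) dt`. -/
def parabolicCylinderD (ν x : ℝ) : ℝ :=
  Real.exp (-x ^ 2 / 4) / Real.Gamma (-ν) *
    ∫ t in Set.Ioi (0 : ℝ), t ^ (-ν - 1) * Real.exp (-t ^ 2 / 2 - x * t)

/-- The Hermite function `H_ν` on the real line, for `ν < 0`. It is determined by the relation
`D_ν(y) = 2^(-ν/2) exp(-y²/4) H_ν(y/√2)` for all `y`, read at `y = √2 x`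
(see `parabolicCylinderD_eq_hermiteH`). -/
def hermiteH (ν x : ℝ) : ℝ :=
  (2 : ℝ) ^ (ν / 2) * Real.exp (x ^ 2 / 2) * parabolicCylinderD ν (Real.sqrt 2 * x)

/-- The ratio `R_ν(x) = H_{ν-1}(x)² / (H_ν(x) H_{ν-2}(x))`. Its denominator is positive
for `ν < 0`, see `hermiteH_pos`. -/
def hermiteRatio (ν x : ℝ) : ℝ :=
  hermiteH (ν - 1) x ^ 2 / (hermiteH ν x * hermiteH (ν - 2) x)

/-- The relation between `D_ν` and `H_ν`. -/
theorem parabolicCylinderD_eq_hermiteH (ν x : ℝ) :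
    parabolicCylinderD ν x =
      (2 : ℝ) ^ (-ν / 2) * Real.exp (-x ^ 2 / 4) * hermiteH ν (x / Real.sqrt 2) := by
  have h2 : Real.sqrt 2 ≠ 0 := by positivity
  have hs : Real.sqrt 2 ^ 2 = 2 := Real.sq_sqrt (by norm_num)
  have e1 : Real.sqrt 2 * (x / Real.sqrt 2) = x := by field_simp
  have e2 : (x / Real.sqrt 2) ^ 2 / 2 = x ^ 2 / 4 := by rw [div_pow, hs]; ring
  have e3 : (2 : ℝ) ^ (-ν / 2) * (2 : ℝ) ^ (ν / 2) = 1 := by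
    rw [← Real.rpow_add (by norm_num)]
    ring_nf
    simp
  have e4 : Real.exp (-x ^ 2 / 4) * Real.exp (x ^ 2 / 4) = 1 := by
    rw [← Real.exp_add]
    ring_nf
    simp
  unfold hermiteH
  rw [e1, e2]
  linear_combination (-(Real.exp (-x ^ 2 / 4) * Real.exp (x ^ 2 / 4)) * parabolicCylinderD ν x) * e3
    - parabolicCylinderD ν x * e4

/-- The integral in the definition of `D_ν` converges for `ν < 0`. -/
theorem parabolicCylinderD_integrableOn {ν : ℝ} (hν : ν < 0) (x : ℝ) :
    MeasureTheory.IntegrableOn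
      (fun t : ℝ => t ^ (-ν - 1) * Real.exp (-t ^ 2 / 2 - x * t)) (Set.Ioi 0) := by
  have h := (integrableOn_rpow_mul_exp_neg_mul_sq (b := 1 / 4) (by norm_num)
    (s := -ν - 1) (by linarith)).const_mul (Real.exp (x ^ 2))
  refine MeasureTheory.Integrable.mono' h (by fun_prop) ?_
  refine (MeasureTheory.ae_restrict_iff' measurableSet_Ioi).2 (Filter.Eventually.of_forall ?_)
  intro t ht
  have ht : (0 : ℝ) < t := ht
  have hp : 0 < t ^ (-ν - 1) := Real.rpow_pos_of_pos ht _
  rw [Real.norm_of_nonneg (by positivity), mul_left_comm, ← Real.exp_add]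
  refine mul_le_mul_of_nonneg_left (Real.exp_le_exp.2 ?_) hp.le
  nlinarith [sq_nonneg (t / 2 + x)]

/-- `D_ν` is positive for `ν < 0`. -/
theorem parabolicCylinderD_pos {ν : ℝ} (hν : ν < 0) (x : ℝ) : 0 < parabolicCylinderD ν x := by
  unfold parabolicCylinderD
  have hpos : ∀ t ∈ Set.Ioi (0 : ℝ), 0 < t ^ (-ν - 1) * Real.exp (-t ^ 2 / 2 - x * t) :=
    fun t ht => mul_pos (Real.rpow_pos_of_pos ht _) (Real.exp_pos _)
  refine mul_pos (div_pos (Real.exp_pos _) (Real.Gamma_pos_of_pos (by linarith))) ?_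
  rw [MeasureTheory.setIntegral_pos_iff_support_of_nonneg_ae
    ((MeasureTheory.ae_restrict_iff' measurableSet_Ioi).2
      (Filter.Eventually.of_forall fun t ht => (hpos t ht).le))
    (parabolicCylinderD_integrableOn hν x)]
  have hsub : Set.Ioi (0 : ℝ) ⊆
      Function.support fun t : ℝ => t ^ (-ν - 1) * Real.exp (-t ^ 2 / 2 - x * t) :=
    fun t ht => (hpos t ht).ne'
  rw [Set.inter_eq_right.2 hsub]
  simp

/-- `H_ν` is positive for `ν < 0`. -/
theorem hermiteH_pos {ν : ℝ} (hν : ν < 0) (x : ℝ) : 0 < hermiteH ν x :=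
  mul_pos (mul_pos (Real.rpow_pos_of_pos (by norm_num) _) (Real.exp_pos _))
    (parabolicCylinderD_pos hν _)

end

open MeasureTheory Set Filter Topology

/-! Put `a = -ν`, let `M_a` be `gaussMoment a` and `r_a = M_{a+1} / M_a`. Up to a positive constant
and the scaling `x ↦ √2 x`, `H_ν` is `M_a`, so the Hermite ratio is a positive constant over
`r_{a+1} / r_a`, and it suffices that this quotient increases strictly. Since `M_a' = -M_{a+1}`, its
logarithmic derivative is `L = 2 r_{a+1} - r_{a+2} - r_a`. The recurrence `r_a (x + r_{a+1}) = a`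
forces `L' < 0` at every zero of `L`, so once `L ≤ 0` it stays so to the right. The quotient would
then be nonincreasing on a half-line, yet it lies strictly below its limit `(a+1)/a` at `+∞`. Hence
`L > 0` everywhere. -/

/-- The weighted moment `∫_0^∞ t^(a-1) exp(-t²/2 - x t) dt`. -/
noncomputable def gaussMoment (a x : ℝ) : ℝ :=
  ∫ t in Set.Ioi (0 : ℝ), t ^ (a - 1) * Real.exp (-t ^ 2 / 2 - x * t)

theorem gaussMoment_integrableOn {a : ℝ} (ha : 0 < a) (x : ℝ) :
    IntegrableOn (fun t : ℝ => t ^ (a - 1) * Real.exp (-t ^ 2 / 2 - x * t)) (Ioi 0) := by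
  simpa using parabolicCylinderD_integrableOn (ν := -a) (by linarith) x

theorem gaussMoment_pos {a : ℝ} (ha : 0 < a) (x : ℝ) : 0 < gaussMoment a x := by
  have h := parabolicCylinderD_pos (ν := -a) (by linarith) x
  unfold parabolicCylinderD at h
  rw [neg_neg] at h
  exact pos_of_mul_pos_right h (div_pos (Real.exp_pos _) (Real.Gamma_pos_of_pos ha)).le

theorem hasDerivAt_gaussMoment {a : ℝ} (ha : 0 < a) (x : ℝ) :
    HasDerivAt (gaussMoment a) (-gaussMoment (a + 1) x) x := by
  have key := hasDerivAt_integral_of_dominated_loc_of_deriv_le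
    (μ := volume.restrict (Ioi (0 : ℝ))) (s := Metric.ball x 1) (x₀ := x)
    (F := fun y t => t ^ (a - 1) * Real.exp (-t ^ 2 / 2 - y * t))
    (F' := fun y t => -(t ^ (a + 1 - 1) * Real.exp (-t ^ 2 / 2 - y * t)))
    -- On the unit ball `y > x - 1`, so the integrand at `x - 1` dominates for `t > 0`.
    (bound := fun t => t ^ (a + 1 - 1) * Real.exp (-t ^ 2 / 2 - (x - 1) * t))
    (Metric.ball_mem_nhds x one_pos)
    (Eventually.of_forall fun y => (gaussMoment_integrableOn ha y).aestronglyMeasurable)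
    (gaussMoment_integrableOn ha x)
    (gaussMoment_integrableOn (by linarith : 0 < a + 1) x).aestronglyMeasurable.neg
    ?_ (gaussMoment_integrableOn (by linarith : 0 < a + 1) (x - 1)) ?_
  · have h := key.2
    rw [integral_neg] at h
    exact h
  · refine (ae_restrict_iff' measurableSet_Ioi).2 (Eventually.of_forall fun t ht y hy => ?_)
    have ht : (0 : ℝ) < t := ht
    have hp : 0 < t ^ (a + 1 - 1) := Real.rpow_pos_of_pos ht _
    rw [norm_neg, Real.norm_of_nonneg (by positivity)]
    refine mul_le_mul_of_nonneg_left (Real.exp_le_exp.2 ?_) hp.le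
    rw [Metric.mem_ball, Real.dist_eq, abs_lt] at hy
    nlinarith [hy.1]
  · refine (ae_restrict_iff' measurableSet_Ioi).2 (Eventually.of_forall fun t ht y _ => ?_)
    have ht : (0 : ℝ) < t := ht
    have h1 : HasDerivAt (fun y : ℝ => -t ^ 2 / 2 - y * t) (-(1 * t)) y :=
      ((hasDerivAt_id y).mul_const t).const_sub _
    have h2 := h1.exp.const_mul (t ^ (a - 1))
    refine h2.congr_deriv ?_
    have : t ^ (a + 1 - 1) = t ^ (a - 1) * t := by
      rw [← Real.rpow_add_one ht.ne']; ring_nf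
    rw [this]; ring

/-- Three-term recurrence, by integration by parts. -/
theorem gaussMoment_add_two {a : ℝ} (ha : 0 < a) (x : ℝ) :
    gaussMoment (a + 2) x = a * gaussMoment a x - x * gaussMoment (a + 1) x := by
  have i0 := gaussMoment_integrableOn ha x
  have i1 := gaussMoment_integrableOn (by linarith : 0 < a + 1) x
  have i2 := gaussMoment_integrableOn (by linarith : 0 < a + 2) x
  set f : ℝ → ℝ := fun t => t ^ (a + 1 - 1) * Real.exp (-t ^ 2 / 2 - x * t) with hf
  set f' : ℝ → ℝ := fun t => a * (t ^ (a - 1) * Real.exp (-t ^ 2 / 2 - x * t))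
    - x * (t ^ (a + 1 - 1) * Real.exp (-t ^ 2 / 2 - x * t))
    - t ^ (a + 2 - 1) * Real.exp (-t ^ 2 / 2 - x * t) with hf'
  have hd : ∀ t ∈ Ioi (0 : ℝ), HasDerivAt f (f' t) t := by
    intro t ht
    have ht : (0 : ℝ) < t := ht
    have h1 : HasDerivAt (fun t : ℝ => -t ^ 2 / 2 - x * t) (-t - x) t := by
      have := (((hasDerivAt_pow 2 t).neg).div_const 2).sub ((hasDerivAt_id t).const_mul x)
      refine this.congr_deriv ?_
      simp
      ring
    have h2 := (Real.hasDerivAt_rpow_const (p := a + 1 - 1) (Or.inl ht.ne')).mul h1.exp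
    refine h2.congr_deriv ?_
    have e1 : t ^ (a + 1 - 1) = t ^ (a - 1) * t := by
      rw [← Real.rpow_add_one ht.ne']; ring_nf
    have e2 : t ^ (a + 2 - 1) = t ^ (a - 1) * t * t := by
      rw [← Real.rpow_add_one ht.ne', ← Real.rpow_add_one ht.ne']; ring_nf
    have e3 : t ^ (a + 1 - 1 - 1) = t ^ (a - 1) := by ring_nf
    simp only [hf']
    rw [e3, e2, e1]; ring
  have hint : IntegrableOn f' (Ioi 0) := ((i0.const_mul a).sub (i1.const_mul x)).sub i2
  have hcont : ContinuousWithinAt f (Ici 0) 0 := by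
    have : ContinuousAt f 0 :=
      (Real.continuousAt_rpow_const 0 _ (Or.inr (by linarith))).mul (by fun_prop)
    exact this.continuousWithinAt
  have hlim : Tendsto f atTop (𝓝 0) :=
    tendsto_zero_of_hasDerivAt_of_integrableOn_Ioi hd hint i1
  have h := integral_Ioi_of_hasDerivAt_of_tendsto hcont hd hint hlim
  have hf0 : f 0 = 0 := by
    simp only [hf]
    rw [Real.zero_rpow (by linarith)]; ring
  have h3 : ∫ t in Ioi (0 : ℝ), f' t =
      a * gaussMoment a x - x * gaussMoment (a + 1) x - gaussMoment (a + 2) x := by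
    simp only [hf', gaussMoment]
    refine (integral_sub ((i0.const_mul a).sub (i1.const_mul x)) i2).trans
      (congrArg₂ (· - ·) ((integral_sub (i0.const_mul a) (i1.const_mul x)).trans ?_) rfl)
    exact congrArg₂ (· - ·) (integral_const_mul _ _) (integral_const_mul _ _)
  rw [h3, hf0] at h
  linarith

/-- Strict Cauchy–Schwarz inequality for consecutive moments. -/
theorem gaussMoment_sq_lt {a : ℝ} (ha : 0 < a) (x : ℝ) :
    gaussMoment (a + 1) x ^ 2 < gaussMoment a x * gaussMoment (a + 2) x := by
  have i0 := gaussMoment_integrableOn ha x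
  have i1 := gaussMoment_integrableOn (by linarith : 0 < a + 1) x
  have i2 := gaussMoment_integrableOn (by linarith : 0 < a + 2) x
  have p0 := gaussMoment_pos ha x
  have p1 := gaussMoment_pos (by linarith : 0 < a + 1) x
  -- With `r` the mean of `t` under the weight of `M_a`, the integral of `g` is the unnormalised
  -- variance `M_{a+2} - r² M_a`.
  obtain ⟨r, hr⟩ : ∃ r, r = gaussMoment (a + 1) x / gaussMoment a x := ⟨_, rfl⟩
  have hr0 : 0 < r := hr ▸ div_pos p1 p0
  set g : ℝ → ℝ := fun t => t ^ (a + 2 - 1) * Real.exp (-t ^ 2 / 2 - x * t)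
    - 2 * r * (t ^ (a + 1 - 1) * Real.exp (-t ^ 2 / 2 - x * t))
    + r ^ 2 * (t ^ (a - 1) * Real.exp (-t ^ 2 / 2 - x * t)) with hg
  have hgeq : ∀ t ∈ Ioi (0 : ℝ),
      g t = t ^ (a - 1) * Real.exp (-t ^ 2 / 2 - x * t) * (t - r) ^ 2 := by
    intro t ht
    have ht : (0 : ℝ) < t := ht
    have e1 : t ^ (a + 1 - 1) = t ^ (a - 1) * t := by
      rw [← Real.rpow_add_one ht.ne']; ring_nf
    have e2 : t ^ (a + 2 - 1) = t ^ (a - 1) * t * t := by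
      rw [← Real.rpow_add_one ht.ne', ← Real.rpow_add_one ht.ne']; ring_nf
    simp only [hg]
    rw [e2, e1]; ring
  have hint : IntegrableOn g (Ioi 0) := (i2.sub (i1.const_mul (2 * r))).add (i0.const_mul (r ^ 2))
  have hval : ∫ t in Ioi (0 : ℝ), g t = gaussMoment (a + 2) x - 2 * r * gaussMoment (a + 1) x
      + r ^ 2 * gaussMoment a x := by
    simp only [hg, gaussMoment]
    refine (integral_add (i2.sub (i1.const_mul (2 * r))) (i0.const_mul (r ^ 2))).trans
      (congrArg₂ (· + ·) ((integral_sub i2 (i1.const_mul (2 * r))).trans ?_)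
        (integral_const_mul _ _))
    exact congrArg₂ (· - ·) rfl (integral_const_mul _ _)
  have hpos : 0 < ∫ t in Ioi (0 : ℝ), g t := by
    rw [setIntegral_pos_iff_support_of_nonneg_ae ((ae_restrict_iff' measurableSet_Ioi).2
      (Eventually.of_forall fun t ht => ?_)) hint]
    · have hsub : Ioi r ⊆ Function.support g ∩ Ioi 0 := by
        intro t ht
        have htr : r < t := ht
        have ht0 : 0 < t := hr0.trans htr
        refine ⟨?_, ht0⟩
        rw [Function.mem_support, hgeq t ht0]
        have := Real.rpow_pos_of_pos ht0 (a - 1)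
        have : 0 < t - r := by linarith
        positivity
      exact lt_of_lt_of_le (by simp) (measure_mono hsub)
    · rw [Pi.zero_apply, hgeq t ht]
      have := Real.rpow_pos_of_pos (show (0 : ℝ) < t from ht) (a - 1)
      positivity
  have e : gaussMoment (a + 1) x = r * gaussMoment a x := by rw [hr]; field_simp
  rw [hval, e] at hpos
  rw [e]
  nlinarith [mul_pos p0 hpos]

/-! ### Ratios of consecutive moments -/

/-- The ratio of consecutive moments. -/
noncomputable def momentRatio (a x : ℝ) : ℝ := gaussMoment (a + 1) x / gaussMoment a x

theorem momentRatio_pos {a : ℝ} (ha : 0 < a) (x : ℝ) : 0 < momentRatio a x :=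
  div_pos (gaussMoment_pos (by linarith) x) (gaussMoment_pos ha x)

theorem momentRatio_lt_succ {a : ℝ} (ha : 0 < a) (x : ℝ) :
    momentRatio a x < momentRatio (a + 1) x := by
  have h := gaussMoment_sq_lt ha x
  unfold momentRatio
  rw [show a + 1 + 1 = a + 2 by ring, div_lt_div_iff₀ (gaussMoment_pos ha x)
    (gaussMoment_pos (by linarith) x)]
  linarith

theorem momentRatio_mul_succ {a : ℝ} (ha : 0 < a) (x : ℝ) :
    momentRatio a x * (x + momentRatio (a + 1) x) = a := by
  have h := gaussMoment_add_two ha x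
  have p0 := (gaussMoment_pos ha x).ne'
  have p1 := (gaussMoment_pos (by linarith : 0 < a + 1) x).ne'
  unfold momentRatio
  rw [show a + 1 + 1 = a + 2 by ring, h]
  field_simp
  ring

theorem hasDerivAt_momentRatio {a : ℝ} (ha : 0 < a) (x : ℝ) :
    HasDerivAt (momentRatio a)
      (momentRatio a x * (momentRatio a x - momentRatio (a + 1) x)) x := by
  have p0 := (gaussMoment_pos ha x).ne'
  have p1 := (gaussMoment_pos (by linarith : 0 < a + 1) x).ne'
  have h := (hasDerivAt_gaussMoment (by linarith : 0 < a + 1) x).div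
    (hasDerivAt_gaussMoment ha x) p0
  refine h.congr_deriv ?_
  unfold momentRatio
  field_simp
  ring

/-- The logarithmic derivative of `momentRatio (a + 1) / momentRatio a`. -/
noncomputable def momentRatioLogDeriv (a x : ℝ) : ℝ :=
  2 * momentRatio (a + 1) x - momentRatio (a + 1 + 1) x - momentRatio a x

theorem hasDerivAt_momentRatio_div {a : ℝ} (ha : 0 < a) (x : ℝ) :
    HasDerivAt (fun y => momentRatio (a + 1) y / momentRatio a y)
      (momentRatio (a + 1) x / momentRatio a x * momentRatioLogDeriv a x) x := by
  have p0 := (momentRatio_pos ha x).ne'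
  refine ((hasDerivAt_momentRatio (by linarith : 0 < a + 1) x).div
    (hasDerivAt_momentRatio ha x) p0).congr_deriv ?_
  unfold momentRatioLogDeriv
  field_simp
  ring

theorem hasDerivAt_momentRatioLogDeriv {a : ℝ} (ha : 0 < a) (x : ℝ) :
    HasDerivAt (momentRatioLogDeriv a)
      (2 * (momentRatio (a + 1) x * (momentRatio (a + 1) x - momentRatio (a + 1 + 1) x))
        - momentRatio (a + 1 + 1) x * (momentRatio (a + 1 + 1) x - momentRatio (a + 1 + 1 + 1) x)
        - momentRatio a x * (momentRatio a x - momentRatio (a + 1) x)) x :=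
  (((hasDerivAt_momentRatio (by linarith : 0 < a + 1) x).const_mul 2).sub
    (hasDerivAt_momentRatio (by linarith : 0 < a + 1 + 1) x)).sub (hasDerivAt_momentRatio ha x)

/-- At a zero of the logarithmic derivative, its derivative is negative. -/
theorem momentRatioLogDeriv_deriv_neg {a : ℝ} (ha : 0 < a) {x : ℝ}
    (h0 : momentRatioLogDeriv a x = 0) :
    2 * (momentRatio (a + 1) x * (momentRatio (a + 1) x - momentRatio (a + 1 + 1) x))
        - momentRatio (a + 1 + 1) x * (momentRatio (a + 1 + 1) x - momentRatio (a + 1 + 1 + 1) x)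
        - momentRatio a x * (momentRatio a x - momentRatio (a + 1) x) < 0 := by
  have hpq := momentRatio_lt_succ ha x
  have r0 := momentRatio_mul_succ ha x
  have r1 := momentRatio_mul_succ (by linarith : 0 < a + 1) x
  have r2 := momentRatio_mul_succ (by linarith : 0 < a + 1 + 1) x
  unfold momentRatioLogDeriv at h0
  generalize momentRatio (a + 1 + 1 + 1) x = w at *
  generalize momentRatio (a + 1 + 1) x = s at *
  generalize momentRatio (a + 1) x = q at *
  generalize momentRatio a x = p at *
  obtain rfl : s = 2 * q - p := by linarith
  -- The combination `r0 - 2 r1 + r2` has right side `0`, and its terms in `x` cancel because `p, q,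
  -- s` are in arithmetic progression. So `s w = 2 q s - p q`, and the expression equals `2 q² - s²
  -- - p² = -2 (q - p)²`.
  nlinarith [sq_pos_of_pos (sub_pos.2 hpq)]

/-- Multiplying the recurrences crosswise gives `a q = p q (x + q)` and `(a + 1) p = p q (x + s)`
for consecutive ratios `p, q, s`; then `q < s` decides. -/
theorem momentRatio_div_lt {a : ℝ} (ha : 0 < a) (x : ℝ) :
    momentRatio (a + 1) x / momentRatio a x < (a + 1) / a := by
  have hqs := momentRatio_lt_succ (by linarith : 0 < a + 1) x
  have hp := momentRatio_pos ha x
  have hq := momentRatio_pos (by linarith : 0 < a + 1) x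
  have r0 := momentRatio_mul_succ ha x
  have r1 := momentRatio_mul_succ (by linarith : 0 < a + 1) x
  rw [div_lt_div_iff₀ hp ha]
  nlinarith [mul_pos (mul_pos hp hq) (sub_pos.2 hqs)]

/-- The recurrence reads `x r_a = a - r_a r_{a+1}`, and `0 < r_b ≤ b / x` makes the product vanish
at infinity. -/
theorem tendsto_mul_momentRatio {a : ℝ} (ha : 0 < a) :
    Tendsto (fun x => x * momentRatio a x) atTop (𝓝 a) := by
  have hb : ∀ {b : ℝ}, 0 < b → ∀ x : ℝ, 0 < x → momentRatio b x ≤ b / x := by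
    intro b hb x hx
    rw [le_div_iff₀ hx]
    nlinarith [momentRatio_mul_succ hb x,
      mul_pos (momentRatio_pos hb x) (momentRatio_pos (by linarith : 0 < b + 1) x)]
  have hz : ∀ {b : ℝ}, 0 < b → Tendsto (momentRatio b) atTop (𝓝 0) := by
    intro b hb'
    refine tendsto_of_tendsto_of_tendsto_of_le_of_le' tendsto_const_nhds
      (tendsto_const_nhds.div_atTop tendsto_id (a := b))
      (Eventually.of_forall fun x => (momentRatio_pos hb' x).le) ?_
    filter_upwards [eventually_gt_atTop 0] with x hx using hb hb' x hx
  have h := ((hz ha).mul (hz (by linarith : 0 < a + 1))).const_sub a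
  rw [mul_zero, sub_zero] at h
  refine h.congr fun x => ?_
  linarith [momentRatio_mul_succ ha x]

theorem tendsto_momentRatio_div {a : ℝ} (ha : 0 < a) :
    Tendsto (fun x => momentRatio (a + 1) x / momentRatio a x) atTop (𝓝 ((a + 1) / a)) := by
  refine ((tendsto_mul_momentRatio (by linarith : 0 < a + 1)).div
    (tendsto_mul_momentRatio ha) ha.ne').congr' ?_
  filter_upwards [eventually_gt_atTop 0] with x hx
  exact mul_div_mul_left _ _ hx.ne'

theorem momentRatioLogDeriv_pos {a : ℝ} (ha : 0 < a) (x₀ : ℝ) : 0 < momentRatioLogDeriv a x₀ := by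
  by_contra! h0
  have hle : ∀ x, x₀ ≤ x → momentRatioLogDeriv a x ≤ 0 := by
    intro x hx
    -- Barrier argument with the constant `0`: the sign of the derivative matters only at zeros.
    exact image_le_of_deriv_right_lt_deriv_boundary (B := fun _ => 0) (B' := fun _ => 0)
      (fun y _ => (hasDerivAt_momentRatioLogDeriv ha y).continuousAt.continuousWithinAt)
      (fun y _ => (hasDerivAt_momentRatioLogDeriv ha y).hasDerivWithinAt) h0
      (fun y => hasDerivAt_const y 0)
      (fun y _ hy => momentRatioLogDeriv_deriv_neg ha hy) (right_mem_Icc.2 hx)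
  have hanti : AntitoneOn (fun y => momentRatio (a + 1) y / momentRatio a y) (Ici x₀) := by
    refine antitoneOn_of_hasDerivWithinAt_nonpos (convex_Ici x₀)
      (fun y _ => (hasDerivAt_momentRatio_div ha y).continuousAt.continuousWithinAt)
      (fun y _ => (hasDerivAt_momentRatio_div ha y).hasDerivWithinAt) fun y hy => ?_
    rw [interior_Ici] at hy
    exact mul_nonpos_of_nonneg_of_nonpos
      (div_pos (momentRatio_pos (by linarith) y) (momentRatio_pos ha y)).le (hle y (le_of_lt hy))
  have hlim : (a + 1) / a ≤ momentRatio (a + 1) x₀ / momentRatio a x₀ := by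
    refine le_of_tendsto (tendsto_momentRatio_div ha) ?_
    filter_upwards [eventually_ge_atTop x₀] with y hy
    exact hanti self_mem_Ici hy hy
  exact absurd (momentRatio_div_lt ha x₀) (not_lt.2 hlim)

theorem momentRatio_div_strictMono {a : ℝ} (ha : 0 < a) :
    StrictMono fun x => momentRatio (a + 1) x / momentRatio a x :=
  strictMono_of_hasDerivAt_pos (fun x => hasDerivAt_momentRatio_div ha x) fun x =>
    mul_pos (div_pos (momentRatio_pos (by linarith) x) (momentRatio_pos ha x))
      (momentRatioLogDeriv_pos ha x)

/-! ### Transfer to the Hermite functions -/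

theorem hermiteH_eq_gaussMoment (ν x : ℝ) :
    hermiteH ν x =
      (2 : ℝ) ^ (ν / 2) / Real.Gamma (-ν) * gaussMoment (-ν) (Real.sqrt 2 * x) := by
  have e : Real.exp (x ^ 2 / 2) * Real.exp (-(Real.sqrt 2 * x) ^ 2 / 4) = 1 := by
    rw [← Real.exp_add, mul_pow, Real.sq_sqrt (by norm_num)]
    ring_nf
    simp
  unfold hermiteH parabolicCylinderD gaussMoment
  generalize (∫ t in Ioi (0 : ℝ),
    t ^ (-ν - 1) * Real.exp (-t ^ 2 / 2 - Real.sqrt 2 * x * t)) = I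
  linear_combination ((2 : ℝ) ^ (ν / 2) / Real.Gamma (-ν) * I) * e

theorem hermiteRatio_eq {ν : ℝ} (hν : ν < 0) :
    ∃ c : ℝ, 0 < c ∧ ∀ x, hermiteRatio ν x =
      c / (momentRatio (-ν + 1) (Real.sqrt 2 * x) / momentRatio (-ν) (Real.sqrt 2 * x)) := by
  have g0 : 0 < (2 : ℝ) ^ (ν / 2) / Real.Gamma (-ν) :=
    div_pos (by positivity) (Real.Gamma_pos_of_pos (by linarith))
  have g1 : 0 < (2 : ℝ) ^ ((ν - 1) / 2) / Real.Gamma (-(ν - 1)) :=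
    div_pos (by positivity) (Real.Gamma_pos_of_pos (by linarith))
  have g2 : 0 < (2 : ℝ) ^ ((ν - 2) / 2) / Real.Gamma (-(ν - 2)) :=
    div_pos (by positivity) (Real.Gamma_pos_of_pos (by linarith))
  refine ⟨_, div_pos (pow_pos g1 2) (mul_pos g0 g2), fun x => ?_⟩
  have p0 := (gaussMoment_pos (by linarith : 0 < -ν) (Real.sqrt 2 * x)).ne'
  have p1 := (gaussMoment_pos (by linarith : 0 < -ν + 1) (Real.sqrt 2 * x)).ne'
  have p2 := (gaussMoment_pos (by linarith : 0 < -ν + 1 + 1) (Real.sqrt 2 * x)).ne'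
  simp only [hermiteRatio, hermiteH_eq_gaussMoment, momentRatio]
  generalize (2 : ℝ) ^ (ν / 2) / Real.Gamma (-ν) = c0 at *
  generalize (2 : ℝ) ^ ((ν - 1) / 2) / Real.Gamma (-(ν - 1)) = c1 at *
  generalize (2 : ℝ) ^ ((ν - 2) / 2) / Real.Gamma (-(ν - 2)) = c2 at *
  rw [show -(ν - 1) = -ν + 1 by ring, show -(ν - 2) = -ν + 1 + 1 by ring]
  field_simp

theorem theorem1 (ν : ℝ) (hν : ν < 0) : StrictAnti (hermiteRatio ν) := by
  obtain ⟨c, hc, h⟩ := hermiteRatio_eq hν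
  have ha : 0 < -ν := by linarith
  intro x y hxy
  rw [h x, h y]
  refine div_lt_div_of_pos_left hc
    (div_pos (momentRatio_pos (by linarith) _) (momentRatio_pos ha _))
    (momentRatio_div_strictMono ha (mul_lt_mul_of_pos_left hxy (by positivity)))
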